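/- All graphs are finite and simple. A colouring of a graph has defect $d$ (respectively, clustering $c$) if every monochromatic component, i.e. every connected component of the subgraph induced by the vertices of one colour, has maximum degree at most $d$ (respectively, has at most $c$ vertices). For a class $\mathcal{G}$ of graphs, closed under isomorphism, the chromatic number of $\mathcal{G}$ is the maximum chromatic number of a graph in $\mathcal{G}$; the defective (respectively, clustered) chromatic number of $\mathcal{G}$ is the minimum integer $m$ for which there is an integer $d$ (respectively, $c$) such that every graph in $\mathcal{G}$ has a colouring with at most $m$ colours with defect $d$ (respectively, with clustering $c$). The treedepth of a graph $G$ is the minimum, over all rooted forests $F$ with vertex set $V(G)$ such that the two ends of each edge of $G$ are in the ancestor–descendant relation of $F$, of the maximum number of vertices in a path of $F$ from a vertex to its root. There is a function $\varepsilon:\mathbb{N}\to\mathbb{R}$ with $\varepsilon(k)\to 0$ as $k\to\infty$ such that the following holds for every integer $k\geq 1$. For the class of triangle-free graphs with treedepth $k$, the chromatic number, the defective chromatic number and the clustered chromatic number are finite and equal, and their common value $c_k$ satisfies $$(1-\varepsilon(k))\sqrt{2k}\;\leq\; c_k\;\leq\;\left\lceil\frac{k+2}{2}\right\rceil.$$ Moreover,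 for the class of triangle-free graphs with treedepth at most $k$, the same three numbers are also all equal to $c_k$. -/

import Mathlib

/-! ### Improper colourings -/

/-- A monochromatic component of `G` under the colouring `col`: a connected component of the
subgraph induced by the vertices of one colour `i`. -/
abbrev MonoComponent {V : Type} {k : ℕ} (G : SimpleGraph V) (col : V → Fin k) (i : Fin k) : Type :=
  (G.induce {v | col v = i}).ConnectedComponent

/-- Every monochromatic component has maximum degree at most `d`. -/
def HasDefect {V : Type} {k : ℕ} (G : SimpleGraph V) (col : V → Fin k) (d : ℕ) : Prop :=
  ∀ (i : Fin k) (C : MonoComponent G col i) (v : C), (C.toSimpleGraph.neighborSet v).ncard ≤ d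

/-- Every monochromatic component has at most `c` vertices. -/
def HasClustering {V : Type} {k : ℕ} (G : SimpleGraph V) (col : V → Fin k) (c : ℕ) : Prop :=
  ∀ (i : Fin k) (C : MonoComponent G col i), C.supp.ncard ≤ c

/-! ### Graph classes and their chromatic numbers -/

/-- A class of finite simple graphs, closed under isomorphism. -/
structure GraphClass where
  /-- Membership of a finite graph in the class. -/
  Mem : ∀ {V : Type} [Finite V], SimpleGraph V → Prop
  iso : ∀ {V W : Type} [Finite V] [Finite W] {G : SimpleGraph V} {H : SimpleGraph W},
    (G ≃g H) → Mem G → Mem H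

namespace GraphClass

/-- The maximum chromatic number of a graph in the class, with value `⊤` if unbounded. -/
noncomputable def chromaticNumber (𝒢 : GraphClass) : ℕ∞ :=
  sSup {n : ℕ∞ | ∃ (V : Type) (_ : Finite V) (G : SimpleGraph V), 𝒢.Mem G ∧ n = G.chromaticNumber}

/-- The least `k` such that, for some `d`, every graph in the class is `k`-colourable with
defect `d`; the value is `⊤` if there is no such `k`. -/
noncomputable def defectiveChromaticNumber (𝒢 : GraphClass) : ℕ∞ :=
  sInf {n : ℕ∞ | ∃ k : ℕ, n = k ∧ ∃ d : ℕ, ∀ (V : Type) [Finite V] (G : SimpleGraph V),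
    𝒢.Mem G → ∃ col : V → Fin k, HasDefect G col d}

/-- The least `k` such that, for some `c`, every graph in the class is `k`-colourable with
clustering `c`; the value is `⊤` if there is no such `k`. -/
noncomputable def clusteredChromaticNumber (𝒢 : GraphClass) : ℕ∞ :=
  sInf {n : ℕ∞ | ∃ k : ℕ, n = k ∧ ∃ c : ℕ, ∀ (V : Type) [Finite V] (G : SimpleGraph V),
    𝒢.Mem G → ∃ col : V → Fin k, HasClustering G col c}

end GraphClass

/-! ### Treedepth -/

/-- A rooted forest with vertex set `V`, given by its parent function; the roots are the vertices
without a parent. On a finite vertex set, acyclicity says that following parents from any vertex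
ends at a root. -/
structure RootedForest (V : Type) where
  /-- The parent of a vertex, `none` at a root. -/
  parent : V → Option V
  acyclic : ∀ v, ¬ Relation.TransGen (fun x y => parent y = some x) v v

namespace RootedForest

variable {V W : Type}

/-- `u` is an ancestor of `v`: it is distinct from `v` and lies on the path from `v` to its root. -/
def IsAncestor (F : RootedForest V) (u v : V) : Prop :=
  Relation.TransGen (fun x y => F.parent y = some x) u v

/-- The number of vertices in the path from `v` to its root. -/
noncomputable def depthOf (F : RootedForest V) (v : V) : ℕ :=
  {u | u = v ∨ F.IsAncestor u v}.ncard

/-- The maximum depth of a vertex (on a finite vertex set; `0` for the empty forest). -/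
noncomputable def depth (F : RootedForest V) : ℕ :=
  ⨆ v, F.depthOf v

/-- The closure of a rooted forest joins every vertex to all of its ancestors. -/
def closure (F : RootedForest V) : SimpleGraph V where
  Adj v w := F.IsAncestor v w ∨ F.IsAncestor w v
  symm := ⟨fun _ _ h => h.symm⟩
  loopless := ⟨fun v h => h.elim (F.acyclic v) (F.acyclic v)⟩

/-- Transport of a rooted forest along a bijection of vertex sets. -/
def mapEquiv (F : RootedForest V) (e : V ≃ W) : RootedForest W where
  parent w := (F.parent (e.symm w)).map e
  acyclic w h := F.acyclic (e.symm w) <| h.lift e.symm fun x y hxy => by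
    obtain ⟨z, hz, rfl⟩ := Option.map_eq_some_iff.1 hxy
    simpa [Function.onFun] using hz

theorem isAncestor_mapEquiv (F : RootedForest V) (e : V ≃ W) (u v : W) :
    (F.mapEquiv e).IsAncestor u v ↔ F.IsAncestor (e.symm u) (e.symm v) := by
  constructor
  · intro h
    refine h.lift e.symm fun x y hxy => ?_
    obtain ⟨z, hz, rfl⟩ := Option.map_eq_some_iff.1 hxy
    simpa [Function.onFun] using hz
  · intro h
    have := h.lift (p := fun x y => (F.mapEquiv e).parent y = some x) e fun x y hxy => by
      simp [Function.onFun, mapEquiv, hxy]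
    simpa [IsAncestor, Function.onFun] using this

theorem depth_mapEquiv (F : RootedForest V) (e : V ≃ W) : (F.mapEquiv e).depth = F.depth := by
  have key : ∀ w, (F.mapEquiv e).depthOf w = F.depthOf (e.symm w) := by
    intro w
    unfold depthOf
    rw [← Set.ncard_image_of_injective _ e.symm.injective]
    congr 1
    ext x
    simp only [Set.mem_image, Set.mem_ofPred_eq, isAncestor_mapEquiv]
    constructor
    · rintro ⟨u, rfl | hu, rfl⟩
      · exact Or.inl rfl
      · exact Or.inr hu
    · rintro (rfl | hx)
      · exact ⟨w, Or.inl rfl, rfl⟩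
      · exact ⟨e x, Or.inr (by simpa using hx), by simp⟩
  unfold depth
  simp only [key]
  exact e.symm.iSup_congr fun _ => rfl

end RootedForest

/-- The minimum depth of a rooted forest on the vertex set of `G` whose closure contains `G` (such
a forest exists whenever `G` is finite). -/
noncomputable def treedepth {V : Type} (G : SimpleGraph V) : ℕ :=
  sInf {n : ℕ | ∃ F : RootedForest V, G ≤ F.closure ∧ F.depth = n}

theorem treedepth_congr {V W : Type} {G : SimpleGraph V} {H : SimpleGraph W} (e : G ≃g H) :
    treedepth G = treedepth H := by
  have key : ∀ {V W : Type} {G : SimpleGraph V} {H : SimpleGraph W} (_ : G ≃g H) (n : ℕ),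
      (∃ F : RootedForest V, G ≤ F.closure ∧ F.depth = n) →
        ∃ F : RootedForest W, H ≤ F.closure ∧ F.depth = n := by
    rintro V W G H e n ⟨F, hF, rfl⟩
    refine ⟨F.mapEquiv e.toEquiv, fun u v huv => ?_, F.depth_mapEquiv _⟩
    have h := hF (e.symm.map_adj_iff.2 huv)
    exact h.imp (F.isAncestor_mapEquiv _ _ _).2 (F.isAncestor_mapEquiv _ _ _).2
  unfold treedepth
  congr 1
  ext n
  exact ⟨key e n, key e.symm n⟩

/-! ### The classes in question -/

/-- The class of triangle-free graphs with treedepth (exactly) `k`. -/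
def triangleFreeTreedepth (k : ℕ) : GraphClass where
  Mem G := G.CliqueFree 3 ∧ treedepth G = k
  iso e h := ⟨h.1.comap e.symm.toEmbedding.isContained, (treedepth_congr e).symm.trans h.2⟩

/-- The class of triangle-free graphs with treedepth at most `k`. -/
def triangleFreeTreedepthLE (k : ℕ) : GraphClass where
  Mem G := G.CliqueFree 3 ∧ treedepth G ≤ k
  iso e h := ⟨h.1.comap e.symm.toEmbedding.isContained, (treedepth_congr e).symm.trans_le h.2⟩

/-- A strict order on `V` in which the elements below any given one form a chain, graded by a
strictly monotone rank with values below `k`. -/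
structure LayeredOrder (V : Type) (k : ℕ) where
  /-- The strict order. -/
  lt : V → V → Prop
  /-- The rank of a vertex. -/
  rank : V → ℕ
  trans : ∀ {u v w}, lt u v → lt v w → lt u w
  chain : ∀ {u v w}, lt u w → lt v w → lt u v ∨ u = v ∨ lt v u
  rank_lt : ∀ {u v}, lt u v → rank u < rank v
  rank_bound : ∀ v, rank v < k

namespace LayeredOrder

variable {V W : Type} {k : ℕ}

/-- Adjacent vertices of `G` are comparable. -/
def Covers (O : LayeredOrder V k) (G : SimpleGraph V) : Prop :=
  ∀ ⦃u v⦄, G.Adj u v → O.lt u v ∨ O.lt v u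

theorem irrefl (O : LayeredOrder V k) (v : V) : ¬ O.lt v v := fun h => (O.rank_lt h).false

theorem asymm (O : LayeredOrder V k) {u v : V} (h : O.lt u v) : ¬ O.lt v u :=
  fun h' => O.irrefl _ (O.trans h h')

theorem ncard_downset_le (O : LayeredOrder V k) (v : V) : {u | u = v ∨ O.lt u v}.ncard ≤ k := by
  have h := Set.ncard_le_ncard_of_injOn (s := {u | u = v ∨ O.lt u v}) (t := Set.Iio k) O.rank
    (fun u _ => O.rank_bound u) ?_ (Set.finite_Iio k)
  · simpa [Set.ncard_eq_toFinset_card'] using h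
  · rintro a (rfl | ha) b (rfl | hb) hab
    · rfl
    · exact absurd hab (O.rank_lt hb).ne'
    · exact absurd hab (O.rank_lt ha).ne
    · rcases O.chain ha hb with h | h | h
      · exact absurd hab (O.rank_lt h).ne
      · exact h
      · exact absurd hab (O.rank_lt h).ne'

theorem card_le (O : LayeredOrder V k) (v : V) (s : Finset V) (h : ∀ u ∈ s, u = v ∨ O.lt u v)
    [Finite V] : s.card ≤ k := by
  rw [← Set.ncard_coe_finset]
  exact (Set.ncard_le_ncard (t := {u | u = v ∨ O.lt u v}) h (Set.toFinite _)).trans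
    (O.ncard_downset_le v)

/-- Restriction of a layered order along an injection. -/
def comap (O : LayeredOrder V k) (f : W → V) (hf : f.Injective) : LayeredOrder W k where
  lt u v := O.lt (f u) (f v)
  rank u := O.rank (f u)
  trans := O.trans
  chain h h' := (O.chain h h').imp id (Or.imp (fun e => hf e) id)
  rank_lt := O.rank_lt
  rank_bound _ := O.rank_bound _

/-- The order that puts two layered orders side by side. -/
def sum (O : LayeredOrder V k) (P : LayeredOrder W k) : LayeredOrder (V ⊕ W) k where
  lt := Sum.LiftRel O.lt P.lt
  rank := Sum.elim O.rank P.rank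
  trans := by
    rintro _ _ _ (h | h) (h' | h')
    exacts [.inl (O.trans h h'), .inr (P.trans h h')]
  chain := by
    rintro _ _ _ (h | h) (h' | h')
    · simpa using O.chain h h'
    · simpa using P.chain h h'
  rank_lt := by
    rintro _ _ (h | h)
    exacts [O.rank_lt h, P.rank_lt h]
  rank_bound := by
    rintro (v | v)
    exacts [O.rank_bound v, P.rank_bound v]

theorem exists_parent (O : LayeredOrder V k) (v : V) : ∃ p : Option V,
    (∀ u, p = some u → O.lt u v) ∧ ∀ u, O.lt u v → ∃ q, p = some q ∧ (u = q ∨ O.lt u q) := by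
  by_cases hv : ∃ u, O.lt u v
  · obtain ⟨q, hq, hmax⟩ : ∃ q, O.lt q v ∧ ∀ u, O.lt u v → O.rank u ≤ O.rank q := by
      classical
      by_contra! hcon
      have : ∀ n, ∃ u, O.lt u v ∧ n ≤ O.rank u := by
        intro n
        induction n with
        | zero => exact hv.imp fun u h => ⟨h, Nat.zero_le _⟩
        | succ n ih =>
          obtain ⟨u, hu, hn⟩ := ih
          obtain ⟨w, hw, hlt⟩ := hcon u hu
          exact ⟨w, hw, by omega⟩
      obtain ⟨u, -, hu⟩ := this k
      exact absurd (O.rank_bound u) (by omega)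
    refine ⟨some q, fun u h => by cases h; exact hq, fun u hu => ⟨q, rfl, ?_⟩⟩
    rcases O.chain hu hq with h | h | h
    · exact Or.inr h
    · exact Or.inl h
    · exact absurd (hmax u hu) (by have := O.rank_lt h; omega)
  · exact ⟨none, by simp, fun u hu => (hv ⟨u, hu⟩).elim⟩

theorem exists_forest (O : LayeredOrder V k) :
    ∃ F : RootedForest V, ∀ u v, F.IsAncestor u v ↔ O.lt u v := by
  choose p hp hp' using O.exists_parent
  have h1 : ∀ u v, Relation.TransGen (fun x y => p y = some x) u v → O.lt u v := by
    intro u v h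
    induction h with
    | single h => exact hp _ _ h
    | tail _ h ih => exact O.trans ih (hp _ _ h)
  have h2 : ∀ n u v, O.rank v = n → O.lt u v →
      Relation.TransGen (fun x y => p y = some x) u v := by
    intro n
    induction n using Nat.strong_induction_on with
    | _ n ih =>
      rintro u v rfl huv
      obtain ⟨q, hq, rfl | hu⟩ := hp' v u huv
      · exact .single hq
      · exact .tail (ih _ (O.rank_lt (hp v q hq)) u q rfl hu) hq
  exact ⟨⟨p, fun v h => O.irrefl v (h1 v v h)⟩, fun u v => ⟨h1 u v, h2 _ u v rfl⟩⟩

theorem treedepth_le [Finite V] {G : SimpleGraph V} (O : LayeredOrder V k) (h : O.Covers G) :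
    treedepth G ≤ k := by
  obtain ⟨F, hF⟩ := O.exists_forest
  have hle : G ≤ F.closure := fun u v huv => by simpa [RootedForest.closure, hF] using h huv
  have hd : F.depth ≤ k := ciSup_le' fun v => by
    simpa [RootedForest.depthOf, hF] using O.ncard_downset_le v
  exact le_trans (b := F.depth) (Nat.sInf_le ⟨F, hle, rfl⟩) hd

end LayeredOrder

namespace RootedForest

variable {V : Type}

theorem isAncestor_chain (F : RootedForest V) {u v w : V} (hu : F.IsAncestor u w)
    (hv : F.IsAncestor v w) : F.IsAncestor u v ∨ u = v ∨ F.IsAncestor v u := by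
  induction hu with
  | single h =>
    rcases Relation.TransGen.tail'_iff.1 hv with ⟨b, hb, h'⟩
    obtain rfl : b = _ := Option.some_injective _ (h'.symm.trans h)
    rcases Relation.reflTransGen_iff_eq_or_transGen.1 hb with h | h
    exacts [Or.inr (Or.inl h), Or.inr (Or.inr h)]
  | tail h1 h ih =>
    rcases Relation.TransGen.tail'_iff.1 hv with ⟨b, hb, h'⟩
    obtain rfl : b = _ := Option.some_injective _ (h'.symm.trans h)
    rcases Relation.reflTransGen_iff_eq_or_transGen.1 hb with rfl | h
    exacts [Or.inl h1, ih h]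

theorem depthOf_lt [Finite V] (F : RootedForest V) {u v : V} (h : F.IsAncestor u v) :
    F.depthOf u < F.depthOf v := by
  refine Set.ncard_lt_ncard ⟨?_, fun hs => ?_⟩ (Set.toFinite _)
  · rintro w (rfl | hw)
    exacts [Or.inr h, Or.inr (hw.trans h)]
  · rcases hs (Or.inl rfl : v ∈ _) with rfl | h'
    exacts [F.acyclic _ h, F.acyclic _ (h.trans h')]

/-- The ancestor order of a rooted forest. -/
noncomputable def toLayeredOrder [Finite V] (F : RootedForest V) : LayeredOrder V F.depth where
  lt := F.IsAncestor
  rank v := F.depthOf v - 1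
  trans h h' := h.trans h'
  chain := F.isAncestor_chain
  rank_lt {u v} h := by
    have h1 := F.depthOf_lt h
    have h2 : 0 < F.depthOf u := (Set.ncard_pos (Set.toFinite _)).2 ⟨u, Or.inl rfl⟩
    omega
  rank_bound v := by
    have h1 : F.depthOf v ≤ F.depth := le_ciSup (f := F.depthOf) (Set.finite_range _).bddAbove v
    have h2 : 0 < F.depthOf v := (Set.ncard_pos (Set.toFinite _)).2 ⟨v, Or.inl rfl⟩
    omega

end RootedForest

theorem LayeredOrder.exists_covers {V : Type} [Finite V] (G : SimpleGraph V) :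
    ∃ O : LayeredOrder V (Nat.card V), O.Covers G := by
  let e := Finite.equivFin V
  refine ⟨⟨fun u v => e u < e v, fun v => e v, lt_trans, fun {u v _} _ _ => ?_, fun h => h,
    fun v => (e v).2⟩, fun u v h => lt_or_gt_of_ne fun he => h.ne (e.injective he)⟩
  rcases lt_trichotomy (e u) (e v) with h | h | h
  exacts [Or.inl h, Or.inr (Or.inl (e.injective h)), Or.inr (Or.inr h)]

theorem treedepth_le_iff {V : Type} [Finite V] {G : SimpleGraph V} {k : ℕ} :
    treedepth G ≤ k ↔ ∃ O : LayeredOrder V k, O.Covers G := by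
  refine ⟨fun h => ?_, fun ⟨O, hO⟩ => O.treedepth_le hO⟩
  have hne : {n : ℕ | ∃ F : RootedForest V, G ≤ F.closure ∧ F.depth = n}.Nonempty := by
    obtain ⟨O, hO⟩ := LayeredOrder.exists_covers G
    obtain ⟨F, hF⟩ := O.exists_forest
    exact ⟨_, F, fun u v huv => by simpa [RootedForest.closure, hF] using hO huv, rfl⟩
  obtain ⟨F, hF, hd⟩ := Nat.sInf_mem hne
  let O := F.toLayeredOrder
  exact ⟨⟨O.lt, O.rank, O.trans, O.chain, O.rank_lt,
    fun v => (O.rank_bound v).trans_le (hd.le.trans h)⟩, fun u v huv => hF huv⟩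

theorem SimpleGraph.cliqueFree_three_iff {V : Type} {G : SimpleGraph V} :
    G.CliqueFree 3 ↔ ∀ a b c, G.Adj a b → G.Adj b c → ¬ G.Adj a c := by
  classical
  refine ⟨fun h a b c hab hbc hac => h {a, b, c} ?_, fun h s hs => ?_⟩
  · exact SimpleGraph.is3Clique_triple_iff.2 ⟨hab, hac, hbc⟩
  · obtain ⟨a, b, c, hab, hac, hbc, -⟩ := SimpleGraph.is3Clique_iff.1 hs
    exact h a b c hab hbc hac

/-- First-fit colouring along a layered order. -/
theorem LayeredOrder.colorable {V : Type} [Finite V] {G : SimpleGraph V} {k : ℕ}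
    (O : LayeredOrder V k) (hO : O.Covers G) (hG : G.CliqueFree 3) : G.Colorable (k / 2 + 1) := by
  classical
  rw [SimpleGraph.cliqueFree_three_iff] at hG
  have hwf : WellFounded O.lt := Subrelation.wf (fun h => O.rank_lt h) (measure O.rank).wf
  let F : (v : V) → ((u : V) → O.lt u v → ℕ) → ℕ := fun v g =>
    sInf {n | ∀ u (h : O.lt u v), G.Adj u v → g u h ≠ n}
  let c : V → ℕ := hwf.fix F
  have hc : ∀ v, c v = sInf {n | ∀ u, O.lt u v → G.Adj u v → c u ≠ n} := fun v => hwf.fix_eq F v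
  have hproper : ∀ u v, O.lt u v → G.Adj u v → c u ≠ c v := by
    intro u v huv hadj
    have hne : {n | ∀ u, O.lt u v → G.Adj u v → c u ≠ n}.Nonempty := by
      obtain ⟨n, hn⟩ := (Set.finite_range c).bddAbove
      exact ⟨n + 1, fun u _ _ h => absurd (hn ⟨u, rfl⟩) (by omega)⟩
    have := Nat.sInf_mem hne
    rw [← hc] at this
    exact this u huv hadj
  have hsmall : ∀ v n, n < c v → ∃ u, O.lt u v ∧ G.Adj u v ∧ c u = n := by
    intro v n hn
    rw [hc] at hn
    simpa using Nat.notMem_of_lt_sInf hn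
  have hbound : ∀ v, 2 * c v ≤ k := by
    intro v
    choose x hx using fun i : Fin (c v) => hsmall v i i.2
    rcases Nat.eq_zero_or_pos (c v) with h0 | hpos
    · omega
    obtain ⟨z, hz, hzv, hcz⟩ := hsmall v (c v - 1) (by omega)
    choose y hy using fun i : Fin (c z) => hsmall z i i.2
    have hxi : x.Injective := fun i j h => Fin.ext (by rw [← (hx i).2.2, ← (hx j).2.2, h])
    have hyi : y.Injective := fun i j h => Fin.ext (by rw [← (hy i).2.2, ← (hy j).2.2, h])
    let A := Finset.univ.image x
    let B := Finset.univ.image y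
    have hA : A.card = c v := by simp [A, Finset.card_image_of_injective _ hxi]
    have hB : B.card = c z := by simp [B, Finset.card_image_of_injective _ hyi]
    have hAB : Disjoint A B := by
      rw [Finset.disjoint_left]
      intro w hwA hwB
      obtain ⟨i, -, rfl⟩ := Finset.mem_image.1 hwA
      obtain ⟨j, -, hj⟩ := Finset.mem_image.1 hwB
      have h1 := (hy j).2.1
      rw [hj] at h1
      exact hG _ _ _ h1 hzv (hx i).2.1
    have hmem : ∀ w ∈ A ∪ B, O.lt w v := by
      intro w hw
      rcases Finset.mem_union.1 hw with h | h
      · obtain ⟨i, -, rfl⟩ := Finset.mem_image.1 h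
        exact (hx i).1
      · obtain ⟨i, -, rfl⟩ := Finset.mem_image.1 h
        exact O.trans (hy i).1 hz
    have hcard := O.card_le v (insert v (A ∪ B)) fun u hu =>
      (Finset.mem_insert.1 hu).imp id (hmem u)
    rw [Finset.card_insert_of_notMem fun h => O.irrefl v (hmem v h),
      Finset.card_union_of_disjoint hAB] at hcard
    omega
  refine ⟨SimpleGraph.Coloring.mk (fun v => ⟨c v, by have := hbound v; omega⟩) ?_⟩
  intro u v huv h
  have h' : c u = c v := congrArg Fin.val h
  rcases hO huv with hlt | hlt
  · exact hproper u v hlt huv h'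
  · exact hproper v u hlt huv.symm h'.symm

/-! ### Online presentation of triangle-free graphs -/

/-- `f` lists, for every time `i < n`, the set of earlier neighbours of the vertex presented at
time `i`, so that the resulting graph is triangle-free. -/
structure IsPlay (f : ℕ → Finset ℕ) (n : ℕ) : Prop where
  lt : ∀ {i j}, i ∈ f j → i < j
  empty : ∀ {i}, n ≤ i → f i = ∅
  triangleFree : ∀ {a b c}, a ∈ f b → b ∈ f c → a ∉ f c

/-- The play `f` up to and including time `i`. -/
def truncatePlay (f : ℕ → Finset ℕ) (i : ℕ) : ℕ → Finset ℕ :=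
  fun j => if j ≤ i then f j else ∅

theorem truncatePlay_of_le (f : ℕ → Finset ℕ) {i j : ℕ} (h : j ≤ i) : truncatePlay f i j = f j :=
  if_pos h

theorem truncatePlay_subset (f : ℕ → Finset ℕ) (i j : ℕ) : truncatePlay f i j ⊆ f j := by
  unfold truncatePlay
  split_ifs <;> simp

theorem IsPlay.truncate {f : ℕ → Finset ℕ} {n : ℕ} (h : IsPlay f n) (i : ℕ) :
    IsPlay (truncatePlay f i) (i + 1) where
  lt hij := h.lt (truncatePlay_subset _ _ _ hij)
  empty hj := if_neg (by omega)
  triangleFree ha hb hc := h.triangleFree (truncatePlay_subset _ _ _ ha)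
    (truncatePlay_subset _ _ _ hb) (truncatePlay_subset _ _ _ hc)

theorem IsPlay.update {f : ℕ → Finset ℕ} {n : ℕ} (h : IsPlay f n) {D : Finset ℕ}
    (hD : ∀ i ∈ D, i < n) (hind : ∀ i ∈ D, ∀ j ∈ D, i ∉ f j) :
    IsPlay (Function.update f n D) (n + 1) where
  lt {i j} hij := by
    rcases eq_or_ne j n with rfl | hj
    · exact hD i (by simpa using hij)
    · exact h.lt (by simpa [hj] using hij)
  empty {i} hi := by
    rw [Function.update_of_ne (by omega), h.empty (by omega)]
  triangleFree {a b c} hab hbc hac := by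
    rcases lt_trichotomy c n with hc | rfl | hc
    · rw [Function.update_of_ne hc.ne] at hbc hac
      rw [Function.update_of_ne ((h.lt hbc).trans hc).ne] at hab
      exact h.triangleFree hab hbc hac
    · rw [Function.update_self] at hbc hac
      rw [Function.update_of_ne (hD b hbc).ne] at hab
      exact hind a hac b hbc hab
    · rw [Function.update_of_ne hc.ne', h.empty hc.le] at hbc
      simp at hbc

/-- A vertex of the universal graph: the last vertex presented in a play of length at most `k`. -/
abbrev OnlineVertex (k : ℕ) : Type :=
  {p : ℕ × (ℕ → Finset ℕ) // p.1 < k ∧ IsPlay p.2 (p.1 + 1)}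

instance (k : ℕ) : Finite (OnlineVertex k) := by
  let F : OnlineVertex k → Fin k × (Fin k → (Finset.range k).powerset) := fun p =>
    (⟨p.1.1, p.2.1⟩, fun i => ⟨p.1.2 i, Finset.mem_powerset.2 fun j hj =>
      Finset.mem_range.2 ((p.2.2.lt hj).trans i.2)⟩)
  refine Finite.of_injective F fun p q h => ?_
  have h1 : p.1.1 = q.1.1 := congrArg (fun z => z.1.1) h
  refine Subtype.ext (Prod.ext h1 (funext fun i => ?_))
  rcases lt_or_ge i k with hi | hi
  · exact congrArg (fun z => (z.2 ⟨i, hi⟩).1) h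
  · rw [p.2.2.empty (by have := p.2.1; omega), q.2.2.empty (by have := q.2.1; omega)]

/-- One play extends another. -/
def onlineOrder (k : ℕ) : LayeredOrder (OnlineVertex k) k where
  lt x y := x.1.1 < y.1.1 ∧ ∀ l ≤ x.1.1, x.1.2 l = y.1.2 l
  rank x := x.1.1
  trans := fun h h' => ⟨h.1.trans h'.1, fun l hl => (h.2 l hl).trans (h'.2 l (hl.trans h.1.le))⟩
  chain {x y z} h h' := by
    rcases lt_trichotomy x.1.1 y.1.1 with hlt | heq | hlt
    · exact Or.inl ⟨hlt, fun l hl => (h.2 l hl).trans (h'.2 l (hl.trans hlt.le)).symm⟩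
    · refine Or.inr (Or.inl (Subtype.ext (Prod.ext heq (funext fun l => ?_))))
      rcases le_or_gt l x.1.1 with hl | hl
      · exact (h.2 l hl).trans (h'.2 l (hl.trans heq.le)).symm
      · rw [x.2.2.empty (by omega), y.2.2.empty (by omega)]
    · exact Or.inr (Or.inr
        ⟨hlt, fun l hl => (h'.2 l hl).trans (h.2 l (hl.trans hlt.le)).symm⟩)
  rank_lt h := h.1
  rank_bound x := x.2.1

/-- The universal online triangle-free graph. -/
def onlineGraph (k : ℕ) : SimpleGraph (OnlineVertex k) where
  Adj x y := ((onlineOrder k).lt x y ∧ x.1.1 ∈ y.1.2 y.1.1) ∨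
    ((onlineOrder k).lt y x ∧ y.1.1 ∈ x.1.2 x.1.1)
  symm := ⟨fun _ _ h => h.symm⟩
  loopless := ⟨fun _ h => h.elim (fun h => (onlineOrder k).irrefl _ h.1)
    fun h => (onlineOrder k).irrefl _ h.1⟩

theorem onlineOrder_covers (k : ℕ) : (onlineOrder k).Covers (onlineGraph k) :=
  fun _ _ h => h.imp And.left And.left

theorem onlineGraph_mem {k : ℕ} {x y : OnlineVertex k} (h : (onlineGraph k).Adj x y)
    (hlt : x.1.1 < y.1.1) : (onlineOrder k).lt x y ∧ x.1.1 ∈ y.1.2 y.1.1 :=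
  h.resolve_right fun h => hlt.not_gt h.1.1

theorem onlineGraph_cliqueFree (k : ℕ) : (onlineGraph k).CliqueFree 3 := by
  have key : ∀ x y z : OnlineVertex k, x.1.1 < y.1.1 → y.1.1 < z.1.1 → (onlineGraph k).Adj x y →
      (onlineGraph k).Adj y z → ¬ (onlineGraph k).Adj x z := by
    intro x y z h1 h2 hxy hyz hxz
    have a := onlineGraph_mem hxy h1
    have b := onlineGraph_mem hyz h2
    have c := onlineGraph_mem hxz (h1.trans h2)
    rw [b.1.2 _ le_rfl] at a
    exact z.2.2.triangleFree a.2 b.2 c.2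
  have hne : ∀ x y : OnlineVertex k, (onlineGraph k).Adj x y → x.1.1 ≠ y.1.1 := fun x y h =>
    h.elim (fun h => h.1.1.ne) fun h => h.1.1.ne'
  rw [SimpleGraph.cliqueFree_three_iff]
  intro x y z hxy hyz hxz
  rcases lt_or_gt_of_ne (hne _ _ hxy) with h1 | h1 <;>
  rcases lt_or_gt_of_ne (hne _ _ hyz) with h2 | h2 <;>
  rcases lt_or_gt_of_ne (hne _ _ hxz) with h3 | h3
  · exact key x y z h1 h2 hxy hyz hxz
  · omega
  · exact key x z y h3 h2 hxz hyz.symm hxy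
  · exact key z x y h3 h1 hxz.symm hxy hyz.symm
  · exact key y x z h1 h3 hxy.symm hxz hyz
  · exact key y z x h2 h3 hyz hxz.symm hxy.symm
  · omega
  · exact key z y x h2 h1 hyz.symm hxy.symm hxz.symm

/-- An online colouring strategy for the first `k` vertices of a triangle-free graph, using the
colours below `m`. -/
structure OnlineStrategy (k m : ℕ) where
  /-- The colour of the vertex presented at time `i` in the play `f`. -/
  color : (ℕ → Finset ℕ) → ℕ → ℕ
  local_ : ∀ {f g i}, (∀ j ≤ i, f j = g j) → color f i = color g i
  proper : ∀ {f n i j}, IsPlay f n → n ≤ k → j < n → i ∈ f j → color f i ≠ color f j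
  lt : ∀ {f n i}, IsPlay f n → n ≤ k → i < n → color f i < m

open Classical in
/-- A proper colouring of the universal graph is an online colouring strategy. -/
noncomputable def onlineStrategyOfColoring {k m : ℕ} (C : (onlineGraph k).Coloring (Fin m)) :
    OnlineStrategy k m where
  color f i := if h : i < k ∧ IsPlay (truncatePlay f i) (i + 1) then
    C ⟨(i, truncatePlay f i), h⟩ else 0
  local_ {f g i} h := by
    have : truncatePlay f i = truncatePlay g i := by
      funext j
      unfold truncatePlay
      split_ifs with hj
      exacts [h j hj, rfl]
    simp only [this]
  proper {f n i j} hf hn hj hij := by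
    have hlt := hf.lt hij
    rw [dif_pos ⟨by omega, hf.truncate i⟩, dif_pos ⟨by omega, hf.truncate j⟩]
    refine fun h => C.valid ?_ (Fin.ext h)
    refine Or.inl ⟨⟨hlt, fun l hl => ?_⟩, ?_⟩
    · exact (truncatePlay_of_le f hl).trans (truncatePlay_of_le f (hl.trans hlt.le)).symm
    · change i ∈ truncatePlay f j j
      rwa [truncatePlay_of_le f le_rfl]
  lt {f n i} hf hn hi := by
    rw [dif_pos ⟨by omega, hf.truncate i⟩]
    exact Fin.is_lt _

namespace OnlineStrategy

variable {k m : ℕ}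

/-- `W` is an independent set of vertices with distinct colours in the play `f` of length `n`. -/
structure Rainbow (S : OnlineStrategy k m) (f : ℕ → Finset ℕ) (n : ℕ) (W : Finset ℕ) : Prop where
  lt : ∀ i ∈ W, i < n
  indep : ∀ i ∈ W, ∀ j ∈ W, i ∉ f j
  injOn : ∀ i ∈ W, ∀ j ∈ W, S.color f i = S.color f j → i = j

theorem Rainbow.mono {S : OnlineStrategy k m} {f : ℕ → Finset ℕ} {n : ℕ} {W W' : Finset ℕ}
    (h : S.Rainbow f n W) (hs : W' ⊆ W) : S.Rainbow f n W' :=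
  ⟨fun i hi => h.lt i (hs hi), fun i hi j hj => h.indep i (hs hi) j (hs hj),
    fun i hi j hj => h.injOn i (hs hi) j (hs hj)⟩

theorem color_update (S : OnlineStrategy k m) (f : ℕ → Finset ℕ) {n i : ℕ} (D : Finset ℕ)
    (h : i < n) : S.color (Function.update f n D) i = S.color f i :=
  S.local_ fun j hj => Function.update_of_ne (by omega) _ _

theorem Rainbow.update {S : OnlineStrategy k m} {f : ℕ → Finset ℕ} {n : ℕ} {W : Finset ℕ}
    (h : S.Rainbow f n W) (D : Finset ℕ) : S.Rainbow (Function.update f n D) (n + 1) W where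
  lt i hi := (h.lt i hi).trans n.lt_succ_self
  indep i hi j hj := by
    rw [Function.update_of_ne (h.lt j hj).ne]
    exact h.indep i hi j hj
  injOn i hi j hj := by
    rw [S.color_update f D (h.lt i hi), S.color_update f D (h.lt j hj)]
    exact h.injOn i hi j hj

theorem Rainbow.insert_new {S : OnlineStrategy k m} {f : ℕ → Finset ℕ} {n : ℕ} {W D : Finset ℕ}
    (hf : IsPlay f n) (h : S.Rainbow f n W) (hDn : ∀ i ∈ D, i < n) (hD : Disjoint D W)
    (hcol : ∀ i ∈ W, S.color f i ≠ S.color (Function.update f n D) n) :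
    S.Rainbow (Function.update f n D) (n + 1) (insert n W) := by
  have h' := h.update D
  have hne : ∀ i ∈ W, S.color (Function.update f n D) i ≠ S.color (Function.update f n D) n :=
    fun i hi => by rw [S.color_update f D (h.lt i hi)]; exact hcol i hi
  refine ⟨?_, ?_, ?_⟩
  · rw [Finset.forall_mem_insert]
    exact ⟨n.lt_succ_self, h'.lt⟩
  · simp only [Finset.forall_mem_insert, Function.update_self]
    refine ⟨⟨fun hn => (hDn n hn).false, fun j hj hn => ?_⟩,
      fun i hi => ⟨fun hi' => ?_, h'.indep i hi⟩⟩
    · rw [Function.update_of_ne (h.lt j hj).ne] at hn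
      exact (hf.lt hn).not_gt (h.lt j hj)
    · exact Finset.disjoint_left.1 hD hi' hi
  · simp only [Finset.forall_mem_insert, true_and, implies_true]
    exact ⟨fun j hj hj' => absurd hj'.symm (hne j hj),
      fun i hi => ⟨fun hi' => absurd hi' (hne i hi), h'.injOn i hi⟩⟩

/-- The stage of the adversary: `X` repeats the colours of `D`, and together with the unused part
`Z` it is independent and rainbow. -/
theorem exists_rainbow_stage (S : OnlineStrategy k m) (z : ℕ) :
    ∀ (f : ℕ → Finset ℕ) (n : ℕ) (X Z D : Finset ℕ), IsPlay f n → n + z + 1 ≤ k → Z.card = z →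
      Disjoint X Z → Disjoint D X → Disjoint D Z → S.Rainbow f n (X ∪ Z) → S.Rainbow f n (D ∪ Z) →
      X.image (S.color f) = D.image (S.color f) →
      ∃ f' n' W, n' ≤ n + z + 1 ∧ IsPlay f' n' ∧ S.Rainbow f' n' W ∧
        W.card = X.card + z + 1 := by
  induction z using Nat.strong_induction_on with
  | _ z ih =>
  intro f n X Z D hf hk hz hXZ hDX hDZ hX hD hcol
  have hDn : ∀ i ∈ D, i < n := fun i hi => hD.lt i (Finset.mem_union_left _ hi)
  have hXn : ∀ i ∈ X, i < n := fun i hi => hX.lt i (Finset.mem_union_left _ hi)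
  have hZn : ∀ i ∈ Z, i < n := fun i hi => hX.lt i (Finset.mem_union_right _ hi)
  have hf' : IsPlay (Function.update f n D) (n + 1) := hf.update hDn
    (hD.mono Finset.subset_union_left).indep
  have hXcol : ∀ i ∈ X, S.color f i ≠ S.color (Function.update f n D) n := by
    intro i hi
    obtain ⟨j, hj, hij⟩ := Finset.mem_image.1 (hcol ▸ Finset.mem_image_of_mem (S.color f) hi)
    rw [← hij, ← S.color_update f D (hDn j hj)]
    exact S.proper hf' (by omega) n.lt_succ_self (by simpa using hj)
  by_cases hy : ∃ y ∈ Z, S.color f y = S.color (Function.update f n D) n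
  · obtain ⟨y, hyZ, hy⟩ := hy
    have hzpos : 0 < Z.card := Finset.card_pos.2 ⟨y, hyZ⟩
    have hyX : y ∉ X := fun h => Finset.disjoint_left.1 hXZ h hyZ
    have hnX : n ∉ X := fun h => (hXn n h).false
    have hnZ : n ∉ Z := fun h => (hZn n h).false
    have hnD : n ∉ D := fun h => (hDn n h).false
    have hny : n ≠ y := (hZn y hyZ).ne'
    have hsub : X ∪ Z.erase y ⊆ X ∪ Z := Finset.union_subset_union_right (Finset.erase_subset _ _)
    have he : Z.erase y ⊆ Z := Finset.erase_subset _ _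
    have hcard : (Z.erase y).card = z - 1 := by rw [Finset.card_erase_of_mem hyZ, hz]
    have hXZ' : Disjoint (insert n X) (Z.erase y) := Finset.disjoint_insert_left.2
      ⟨fun h => hnZ (he h), hXZ.mono_right he⟩
    have hDX' : Disjoint (insert y D) (insert n X) := by
      rw [Finset.disjoint_insert_left, Finset.disjoint_insert_right]
      exact ⟨fun h => (Finset.mem_insert.1 h).elim (fun h => hny h.symm) hyX, hnD, hDX⟩
    have hDZ' : Disjoint (insert y D) (Z.erase y) := Finset.disjoint_insert_left.2
      ⟨Finset.notMem_erase _ _, hDZ.mono_right he⟩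
    have hX' : S.Rainbow (Function.update f n D) (n + 1) (insert n X ∪ Z.erase y) := by
      rw [Finset.insert_union]
      refine Rainbow.insert_new hf (hX.mono hsub) hDn
        (Finset.disjoint_union_right.2 ⟨hDX, hDZ.mono_right he⟩) ?_
      intro i hi
      rcases Finset.mem_union.1 hi with h | h
      · exact hXcol i h
      · rw [← hy]
        intro hiy
        exact Finset.ne_of_mem_erase h (hX.injOn i (hsub hi) y (Finset.mem_union_right _ hyZ) hiy)
    have hD' : S.Rainbow (Function.update f n D) (n + 1) (insert y D ∪ Z.erase y) := by
      rw [Finset.insert_union, ← Finset.union_insert, Finset.insert_erase hyZ]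
      exact hD.update D
    have hc : ∀ A : Finset ℕ, (∀ i ∈ A, i < n) →
        A.image (S.color (Function.update f n D)) = A.image (S.color f) := fun A hA =>
      Finset.image_congr fun i hi => S.color_update f D (hA i hi)
    have hcol' : (insert n X).image (S.color (Function.update f n D)) =
        (insert y D).image (S.color (Function.update f n D)) := by
      rw [Finset.image_insert, Finset.image_insert, hc X hXn, hc D hDn, hcol, ← hy,
        S.color_update f D (hZn y hyZ)]
    obtain ⟨f', n', W, h1, h2, h3, h4⟩ := ih (z - 1) (by omega) _ (n + 1) _ _ _ hf' (by omega)
      hcard hXZ' hDX' hDZ' hX' hD' hcol'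
    rw [Finset.card_insert_of_notMem hnX] at h4
    exact ⟨f', n', W, by omega, h2, h3, by omega⟩
  · push Not at hy
    refine ⟨_, n + 1, _, by omega, hf', Rainbow.insert_new hf hX hDn
      (Finset.disjoint_union_right.2 ⟨hDX, hDZ⟩) ?_, ?_⟩
    · intro i hi
      exact (Finset.mem_union.1 hi).elim (hXcol i) (hy i)
    · rw [Finset.card_insert_of_notMem fun h => (hX.lt n h).false,
        Finset.card_union_of_disjoint hXZ, hz]

theorem exists_rainbow (S : OnlineStrategy k m) (l : ℕ) (hl : l * (l + 1) ≤ 2 * k) :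
    ∃ f n W, 2 * n ≤ l * (l + 1) ∧ IsPlay f n ∧ S.Rainbow f n W ∧ W.card = l := by
  induction l with
  | zero =>
    exact ⟨fun _ => ∅, 0, ∅, by simp, ⟨by simp, by simp, by simp⟩, ⟨by simp, by simp, by simp⟩, rfl⟩
  | succ l ih =>
    have e : (l + 1) * (l + 1 + 1) = l * (l + 1) + 2 * (l + 1) := by ring
    obtain ⟨f, n, W, hn, hf, hW, hc⟩ := ih (by omega)
    obtain ⟨f', n', W', h1, h2, h3, h4⟩ := S.exists_rainbow_stage l f n ∅ W ∅ hf (by omega) hc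
      (by simp) (by simp) (by simp) (by simpa using hW) (by simpa using hW) rfl
    exact ⟨f', n', W', by omega, h2, h3, by simpa using h4⟩

theorem le_of_mul_le (S : OnlineStrategy k m) {l : ℕ} (hl : l * (l + 1) ≤ 2 * k) : l ≤ m := by
  obtain ⟨f, n, W, hn, hf, hW, rfl⟩ := S.exists_rainbow l hl
  have := Finset.card_le_card_of_injOn (s := W) (t := Finset.range m) (S.color f)
    (fun i hi => Finset.mem_coe.2 (Finset.mem_range.2 (S.lt hf (by omega) (hW.lt i hi)))) hW.injOn
  simpa using this

end OnlineStrategy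

theorem le_of_colorable_onlineGraph {k m l : ℕ} (h : (onlineGraph k).Colorable m)
    (hl : l * (l + 1) ≤ 2 * k) : l ≤ m :=
  h.elim fun C => (onlineStrategyOfColoring C).le_of_mul_le hl

/-! ### Defective colourings and blow-ups -/

theorem hasDefect_iff {V : Type} [Finite V] {m : ℕ} {G : SimpleGraph V} {col : V → Fin m} {d : ℕ} :
    HasDefect G col d ↔ ∀ v, {w | G.Adj v w ∧ col w = col v}.ncard ≤ d := by
  have key : ∀ (i : Fin m) (C : MonoComponent G col i) (v : C),
      (fun w : C => w.1.1) '' C.toSimpleGraph.neighborSet v =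
        {w | G.Adj v.1.1 w ∧ col w = col v.1.1} := by
    intro i C v
    ext w
    constructor
    · rintro ⟨w, hw, rfl⟩
      exact ⟨hw, w.1.2.trans v.1.2.symm⟩
    · rintro ⟨hw, hc⟩
      have hadj : (G.induce {v | col v = i}).Adj v.1 ⟨w, hc.trans v.1.2⟩ := hw
      exact ⟨⟨⟨w, hc.trans v.1.2⟩, C.mem_supp_of_adj_mem_supp v.2 hadj⟩, hw, rfl⟩
  have hinj : ∀ (i : Fin m) (C : MonoComponent G col i),
      Function.Injective (fun w : C => w.1.1) := fun i C a b h => Subtype.ext (Subtype.ext h)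
  constructor
  · intro h v
    let C := (G.induce {w | col w = col v}).connectedComponentMk ⟨v, rfl⟩
    have := h (col v) C ⟨⟨v, rfl⟩, rfl⟩
    rwa [← Set.ncard_image_of_injective _ (hinj _ C), key] at this
  · intro h i C v
    rw [← Set.ncard_image_of_injective _ (hinj _ C), key]
    exact h _

theorem HasDefect.comap {V W : Type} [Finite V] [Finite W] {m d : ℕ} {G : SimpleGraph V}
    {H : SimpleGraph W} {col : W → Fin m} (h : HasDefect H col d) (f : V → W) (hf : f.Injective)
    (hadj : ∀ u v, G.Adj u v → H.Adj (f u) (f v)) : HasDefect G (fun v => col (f v)) d := by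
  rw [hasDefect_iff] at h ⊢
  intro v
  rw [← Set.ncard_image_of_injective _ hf]
  refine (Set.ncard_le_ncard ?_ (Set.toFinite _)).trans (h (f v))
  rintro _ ⟨w, ⟨hw, hc⟩, rfl⟩
  exact ⟨hadj _ _ hw, hc⟩

namespace LayeredOrder

variable {V : Type} {k : ℕ}

/-- A vertex together with indices below `N + 1` for itself and the vertices below it; other
vertices carry the index `0`. -/
abbrev BlowupVertex (O : LayeredOrder V k) (N : ℕ) : Type :=
  {p : V × (V → Fin (N + 1)) // ∀ u, ¬ (u = p.1 ∨ O.lt u p.1) → p.2 u = 0}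

/-- The order on the blow-up: indices agree along the lower vertex. -/
def blowup (O : LayeredOrder V k) (N : ℕ) : LayeredOrder (O.BlowupVertex N) k where
  lt x y := O.lt x.1.1 y.1.1 ∧ ∀ u, u = x.1.1 ∨ O.lt u x.1.1 → x.1.2 u = y.1.2 u
  rank x := O.rank x.1.1
  trans h h' := ⟨O.trans h.1 h'.1, fun u hu => (h.2 u hu).trans
    (h'.2 u (Or.inr (hu.elim (fun e => e ▸ h.1) fun h'' => O.trans h'' h.1)))⟩
  chain {x y z} h h' := by
    rcases O.chain h.1 h'.1 with hlt | heq | hlt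
    · exact Or.inl ⟨hlt, fun u hu => (h.2 u hu).trans
        (h'.2 u (Or.inr (hu.elim (fun e => e ▸ hlt) fun h'' => O.trans h'' hlt))).symm⟩
    · refine Or.inr (Or.inl (Subtype.ext (Prod.ext heq (funext fun u => ?_))))
      by_cases hu : u = x.1.1 ∨ O.lt u x.1.1
      · exact (h.2 u hu).trans (h'.2 u (heq ▸ hu)).symm
      · rw [x.2 u hu, y.2 u (heq ▸ hu)]
    · exact Or.inr (Or.inr ⟨hlt, fun u hu => (h'.2 u hu).trans
        (h.2 u (Or.inr (hu.elim (fun e => e ▸ hlt) fun h'' => O.trans h'' hlt))).symm⟩)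
  rank_lt h := O.rank_lt h.1
  rank_bound x := O.rank_bound _

/-- The blow-up of `G`, in which every vertex has `N + 1` copies above each copy of the vertices
below it. -/
def blowupGraph (O : LayeredOrder V k) (N : ℕ) (G : SimpleGraph V) :
    SimpleGraph (O.BlowupVertex N) where
  Adj x y := G.Adj x.1.1 y.1.1 ∧ ((O.blowup N).lt x y ∨ (O.blowup N).lt y x)
  symm := ⟨fun _ _ h => ⟨h.1.symm, h.2.symm⟩⟩
  loopless := ⟨fun _ h => h.1.ne rfl⟩

theorem blowup_covers (O : LayeredOrder V k) (N : ℕ) (G : SimpleGraph V) :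
    (O.blowup N).Covers (O.blowupGraph N G) := fun _ _ h => h.2

theorem blowupGraph_cliqueFree (O : LayeredOrder V k) (N : ℕ) {G : SimpleGraph V}
    (h : G.CliqueFree 3) : (O.blowupGraph N G).CliqueFree 3 := by
  rw [SimpleGraph.cliqueFree_three_iff] at h ⊢
  exact fun a b c hab hbc hac => h _ _ _ hab.1 hbc.1 hac.1

open Classical in
/-- The copy of `v` with the indices given by `f`. -/
noncomputable def blowupCopy (O : LayeredOrder V k) {N : ℕ} (f : V → Fin (N + 1)) (v : V) :
    O.BlowupVertex N :=
  ⟨(v, fun u => if u = v ∨ O.lt u v then f u else 0), fun _ hu => if_neg hu⟩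

theorem blowupCopy_congr (O : LayeredOrder V k) {N : ℕ} {f g : V → Fin (N + 1)} {v : V}
    (h : ∀ u, u = v ∨ O.lt u v → f u = g u) : O.blowupCopy f v = O.blowupCopy g v := by
  refine Subtype.ext (Prod.ext rfl (funext fun u => ?_))
  simp only [blowupCopy]
  split_ifs with hu
  exacts [h u hu, rfl]

theorem blowupCopy_lt (O : LayeredOrder V k) {N : ℕ} (f : V → Fin (N + 1)) {u v : V}
    (h : O.lt u v) : (O.blowup N).lt (O.blowupCopy f u) (O.blowupCopy f v) := by
  refine ⟨h, fun w hw => ?_⟩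
  have hw' : w = v ∨ O.lt w v := Or.inr (hw.elim (fun e => e ▸ h) fun h' => O.trans h' h)
  simp only [blowupCopy] at hw ⊢
  rw [if_pos hw, if_pos hw']

open Classical in
theorem exists_good_index [Finite V] (O : LayeredOrder V k) (G : SimpleGraph V) {m d : ℕ}
    {col : O.BlowupVertex (Nat.card V * d) → Fin m}
    (hcol : HasDefect (O.blowupGraph (Nat.card V * d) G) col d)
    (f : V → Fin (Nat.card V * d + 1)) (v : V) :
    ∃ i, ∀ u, O.lt u v → G.Adj u v →
      col (O.blowupCopy f u) ≠ col (O.blowupCopy (Function.update f v i) v) := by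
  have := Fintype.ofFinite V
  by_contra! hcon
  choose u hu hadj hc using hcon
  obtain ⟨w, -, hw⟩ := Finset.exists_lt_card_fiber_of_mul_lt_card_of_maps_to
    (s := Finset.univ) (t := Finset.univ) (f := u) (n := d) (fun _ _ => Finset.mem_univ _)
    (by simp [Nat.card_eq_fintype_card])
  have hlt := (Finset.card_pos.1 ((Nat.zero_le d).trans_lt hw))
  let F := fun i => O.blowupCopy (Function.update f v i) v
  have hF : F.Injective := fun i j h => by
    have := congrArg (fun x => x.1.2 v) h
    simpa [F, blowupCopy] using this
  refine absurd (hasDefect_iff.1 hcol (O.blowupCopy f w)) (not_le.2 (hw.trans_le ?_))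
  rw [← Finset.card_image_of_injective _ hF, ← Set.ncard_coe_finset]
  refine Set.ncard_le_ncard ?_ (Set.toFinite _)
  intro x hx
  obtain ⟨i, hi, rfl⟩ := Finset.mem_image.1 (Finset.mem_coe.1 hx)
  obtain rfl := (Finset.mem_filter.1 hi).2
  have e : O.blowupCopy f (u i) = O.blowupCopy (Function.update f v i) (u i) :=
    O.blowupCopy_congr fun z hz => by
      rw [Function.update_of_ne]
      intro e
      rcases hz with h | h
      · exact O.irrefl v (by have := hu i; rwa [← h, e] at this)
      · exact O.asymm (hu i) (e ▸ h)
  refine ⟨⟨hadj i, Or.inl ?_⟩, (hc i).symm⟩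
  rw [e]
  exact O.blowupCopy_lt _ (hu i)

open Classical in
theorem colorable_of_hasDefect_blowup [Finite V] (O : LayeredOrder V k) {G : SimpleGraph V}
    (hO : O.Covers G) {m d : ℕ} {col : O.BlowupVertex (Nat.card V * d) → Fin m}
    (hcol : HasDefect (O.blowupGraph (Nat.card V * d) G) col d) : G.Colorable m := by
  have key : ∀ n, ∃ f : V → Fin (Nat.card V * d + 1), ∀ u v, O.rank v < n → O.lt u v →
      G.Adj u v → col (O.blowupCopy f u) ≠ col (O.blowupCopy f v) := by
    intro n
    induction n with
    | zero => exact ⟨fun _ => 0, fun u v h => absurd h (Nat.not_lt_zero _)⟩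
    | succ n ih =>
      obtain ⟨f, hf⟩ := ih
      choose i hi using O.exists_good_index G hcol f
      let g : V → Fin (Nat.card V * d + 1) := fun v => if O.rank v = n then i v else f v
      have hlow : ∀ v, O.rank v < n → O.blowupCopy g v = O.blowupCopy f v := fun v hv =>
        O.blowupCopy_congr fun u hu => if_neg
          (((hu.elim (fun e => e ▸ le_rfl) fun h => (O.rank_lt h).le).trans_lt hv).ne)
      refine ⟨g, fun u v hv huv hadj => ?_⟩
      have hr := O.rank_lt huv
      rw [hlow u (by omega)]
      rcases Nat.lt_succ_iff_lt_or_eq.1 hv with h | h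
      · rw [hlow v h]
        exact hf u v h huv hadj
      · have : O.blowupCopy g v = O.blowupCopy (Function.update f v (i v)) v :=
          O.blowupCopy_congr fun w hw => by
            rcases hw with rfl | hw
            · simp [g, h]
            · have hwv := O.rank_lt hw
              rw [Function.update_of_ne (by rintro rfl; exact O.irrefl _ hw)]
              exact if_neg (by omega)
        rw [this]
        exact hi v u huv hadj
  obtain ⟨f, hf⟩ := key k
  refine ⟨SimpleGraph.Coloring.mk (fun v => col (O.blowupCopy f v)) fun {u v} huv h => ?_⟩
  rcases hO huv with hlt | hlt
  · exact hf u v (O.rank_bound v) hlt huv h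
  · exact hf v u (O.rank_bound u) hlt huv.symm h.symm

end LayeredOrder

/-! ### Graphs of prescribed treedepth -/

theorem LayeredOrder.lt_of_degree {V : Type} [Finite V] [Nonempty V] {G : SimpleGraph V} {k δ : ℕ}
    (O : LayeredOrder V k) (hO : O.Covers G) (h : ∀ v, δ ≤ (G.neighborSet v).ncard) : δ < k := by
  obtain ⟨v, hv⟩ := Finite.exists_max O.rank
  have hsub : insert v (G.neighborSet v) ⊆ {u | u = v ∨ O.lt u v} := by
    rintro u (rfl | hu)
    · exact Or.inl rfl
    · exact Or.inr ((hO hu).resolve_left fun h => (O.rank_lt h).not_ge (hv u))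
  have := (Set.ncard_le_ncard hsub (Set.toFinite _)).trans (O.ncard_downset_le v)
  rw [Set.ncard_insert_of_notMem (by simp)] at this
  exact (h v).trans_lt this

/-- The complete bipartite graph whose first side is a chain below its second side. -/
def completeBipartiteOrder (n : ℕ) : LayeredOrder (Fin n ⊕ Fin (n + 1)) (n + 1) where
  lt := Sum.elim (fun i => Sum.elim (fun j => i < j) fun _ => True) fun _ _ => False
  rank := Sum.elim (fun i => i) fun _ => n
  trans {u v w} h h' := by
    rcases u with u | u <;> rcases v with v | v <;> rcases w with w | w <;>
      simp_all
    exact h.trans h'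
  chain {u v w} h h' := by
    rcases u with u | u <;> rcases v with v | v <;> rcases w with w | w <;> simp_all
    · exact lt_trichotomy u v
    · exact lt_trichotomy u v
  rank_lt {u v} h := by
    rcases u with u | u <;> rcases v with v | v <;> simp_all
  rank_bound v := by
    rcases v with v | v <;> simp

theorem exists_sum_treedepth_eq {V : Type} [Finite V] {G : SimpleGraph V} {k : ℕ} (hk : 1 ≤ k)
    (hG : G.CliqueFree 3) (ht : treedepth G ≤ k) :
    ∃ (W : Type) (_ : Finite W) (H : SimpleGraph W) (f : V → W), f.Injective ∧
      (∀ u v, G.Adj u v → H.Adj (f u) (f v)) ∧ H.CliqueFree 3 ∧ treedepth H = k := by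
  obtain ⟨n, rfl⟩ : ∃ n, k = n + 1 := ⟨k - 1, by omega⟩
  let K := completeBipartiteGraph (Fin n) (Fin (n + 1))
  obtain ⟨O, hO⟩ := treedepth_le_iff.1 ht
  refine ⟨V ⊕ (Fin n ⊕ Fin (n + 1)), inferInstance, G ⊕g K, Sum.inl, Sum.inl_injective,
    fun u v h => h, ?_, le_antisymm ?_ ?_⟩
  · rw [SimpleGraph.cliqueFree_three_iff] at hG ⊢
    rintro (a | a | a) (b | b | b) (c | c | c) <;> simp [K]
    exact hG a b c
  · refine treedepth_le_iff.2 ⟨O.sum (completeBipartiteOrder n), ?_⟩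
    rintro (a | a) (b | b) h
    · exact (hO h).imp .inl .inl
    · exact (SimpleGraph.not_adj_sum_inl_inr a b h).elim
    · exact (SimpleGraph.not_adj_sum_inl_inr b a h.symm).elim
    · have h' : K.Adj a b := h
      have : (completeBipartiteOrder n).lt a b ∨ (completeBipartiteOrder n).lt b a := by
        rcases a with a | a <;> rcases b with b | b <;> simp_all [K, completeBipartiteOrder]
      exact this.imp .inr .inr
  · obtain ⟨P, hP⟩ := treedepth_le_iff.1 (le_refl (treedepth (G ⊕g K)))
    have hcov : (P.comap Sum.inr Sum.inr_injective).Covers K := fun u v h => hP h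
    refine LayeredOrder.lt_of_degree _ hcov ?_
    rintro (v | v)
    · have : K.neighborSet (Sum.inl v) = Set.range Sum.inr := by
        ext (w | w) <;> simp [K]
      rw [this, ← Set.image_univ, Set.ncard_image_of_injective _ Sum.inr_injective]
      simp
    · have : K.neighborSet (Sum.inr v) = Set.range Sum.inl := by
        ext (w | w) <;> simp [K]
      rw [this, ← Set.image_univ, Set.ncard_image_of_injective _ Sum.inl_injective]
      simp

/-! ### The chromatic numbers of the classes -/

theorem hasClustering_of_coloring {V : Type} {m : ℕ} {G : SimpleGraph V} (C : G.Coloring (Fin m)) :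
    HasClustering G C 1 := by
  have hbot : ∀ i, G.induce {v | C v = i} = ⊥ := fun i => by
    ext u v
    simp only [SimpleGraph.bot_adj, iff_false]
    exact fun h => C.valid h (u.2.trans v.2.symm)
  intro i K
  have hK : K.supp.Subsingleton := fun u hu v hv => by
    have h : (G.induce {v | C v = i}).Reachable u v :=
      SimpleGraph.ConnectedComponent.exact (hu.trans hv.symm)
    rw [hbot] at h
    simpa using h
  exact (Set.ncard_le_one hK.finite).2 fun u hu v hv => hK hu hv

theorem HasClustering.hasDefect {V : Type} [Finite V] {m c : ℕ} {G : SimpleGraph V}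
    {col : V → Fin m} (h : HasClustering G col c) : HasDefect G col c := by
  intro i K v
  rw [← Set.ncard_image_of_injective _ Subtype.val_injective]
  refine (Set.ncard_le_ncard ?_ (Set.toFinite _)).trans (h i K)
  rintro _ ⟨w, -, rfl⟩
  exact w.2

theorem GraphClass.chromaticNumbers_eq {𝒢 : GraphClass} {c : ℕ}
    (h1 : ∀ (V : Type) [Finite V] (G : SimpleGraph V), 𝒢.Mem G → G.Colorable c)
    (h2 : ∀ m d : ℕ, (∀ (V : Type) [Finite V] (G : SimpleGraph V), 𝒢.Mem G →
      ∃ col : V → Fin m, HasDefect G col d) → c ≤ m) :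
    𝒢.chromaticNumber = c ∧ 𝒢.defectiveChromaticNumber = c ∧ 𝒢.clusteredChromaticNumber = c := by
  have hclus : 𝒢.clusteredChromaticNumber ≤ c :=
    sInf_le ⟨c, rfl, 1, fun V _ G hG => (h1 V G hG).elim fun C => ⟨C, hasClustering_of_coloring C⟩⟩
  have hdc : 𝒢.defectiveChromaticNumber ≤ 𝒢.clusteredChromaticNumber := by
    refine sInf_le_sInf ?_
    rintro _ ⟨m, rfl, b, h⟩
    exact ⟨m, rfl, b, fun V _ G hG => (h V G hG).imp fun _ => HasClustering.hasDefect⟩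
  have hdef : (c : ℕ∞) ≤ 𝒢.defectiveChromaticNumber := by
    refine le_sInf ?_
    rintro _ ⟨m, rfl, d, h⟩
    exact_mod_cast h2 m d h
  have hchr : 𝒢.chromaticNumber ≤ c := by
    refine sSup_le ?_
    rintro _ ⟨V, _, G, hG, rfl⟩
    exact SimpleGraph.chromaticNumber_le_iff_colorable.2 (h1 V G hG)
  refine ⟨le_antisymm hchr ?_, le_antisymm (hdc.trans hclus) hdef,
    le_antisymm hclus (hdef.trans hdc)⟩
  obtain ⟨m, hm⟩ := ENat.ne_top_iff_exists.1 (ne_top_of_le_ne_top (ENat.natCast_ne_top c) hchr)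
  rw [← hm]
  refine Nat.cast_le.2 (h2 m 1 fun V _ G hG => ?_)
  have : G.chromaticNumber ≤ m := hm ▸ le_sSup ⟨V, ‹_›, G, hG, rfl⟩
  obtain ⟨C⟩ := SimpleGraph.chromaticNumber_le_iff_colorable.1 this
  exact ⟨C, (hasClustering_of_coloring C).hasDefect⟩

theorem colorable_of_forall_hasDefect {k m d : ℕ} (hk : 1 ≤ k)
    (h : ∀ (V : Type) [Finite V] (G : SimpleGraph V), (triangleFreeTreedepth k).Mem G →
      ∃ col : V → Fin m, HasDefect G col d)
    {V : Type} [Finite V] {G : SimpleGraph V} (hG : G.CliqueFree 3) (ht : treedepth G ≤ k) :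
    G.Colorable m := by
  obtain ⟨O, hO⟩ := treedepth_le_iff.1 ht
  obtain ⟨W, _, H, f, hf, hadj, hH, htH⟩ := exists_sum_treedepth_eq hk
    (O.blowupGraph_cliqueFree (Nat.card V * d) hG) ((O.blowup _).treedepth_le (O.blowup_covers _ G))
  obtain ⟨col, hcol⟩ := h W H ⟨hH, htH⟩
  exact O.colorable_of_hasDefect_blowup hO (hcol.comap f hf hadj)

theorem tendsto_two_div_sqrt :
    Filter.Tendsto (fun k : ℕ => 2 / Real.sqrt (2 * k)) Filter.atTop (nhds 0) :=
  tendsto_const_nhds.div_atTop (Real.tendsto_sqrt_atTop.comp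
    (tendsto_natCast_atTop_atTop.const_mul_atTop two_pos))

theorem mainTheorem5 :
    ∃ ε : ℕ → ℝ, Filter.Tendsto ε Filter.atTop (nhds 0) ∧
      ∀ k : ℕ, 1 ≤ k → ∃ c : ℕ,
        ((triangleFreeTreedepth k).chromaticNumber = c ∧
          (triangleFreeTreedepth k).defectiveChromaticNumber = c ∧
          (triangleFreeTreedepth k).clusteredChromaticNumber = c) ∧
        ((triangleFreeTreedepthLE k).chromaticNumber = c ∧
          (triangleFreeTreedepthLE k).defectiveChromaticNumber = c ∧
          (triangleFreeTreedepthLE k).clusteredChromaticNumber = c) ∧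
        (1 - ε k) * Real.sqrt (2 * k) ≤ c ∧
        c ≤ ⌈((k : ℝ) + 2) / 2⌉₊ := by
  classical
  refine ⟨fun k => 2 / Real.sqrt (2 * k), tendsto_two_div_sqrt, fun k hk => ?_⟩
  have hex : ∃ m, ∀ (V : Type) [Finite V] (G : SimpleGraph V), G.CliqueFree 3 →
      treedepth G ≤ k → G.Colorable m := ⟨k / 2 + 1, fun V _ G hG ht => by
    obtain ⟨O, hO⟩ := treedepth_le_iff.1 ht
    exact O.colorable hO hG⟩
  have hle : Nat.find hex ≤ k / 2 + 1 := Nat.find_min' hex fun V _ G hG ht => by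
    obtain ⟨O, hO⟩ := treedepth_le_iff.1 ht
    exact O.colorable hO hG
  have hmin : ∀ m d : ℕ, (∀ (V : Type) [Finite V] (G : SimpleGraph V),
      (triangleFreeTreedepth k).Mem G → ∃ col : V → Fin m, HasDefect G col d) →
      Nat.find hex ≤ m := fun m d h =>
    Nat.find_min' hex fun V _ G hG ht => colorable_of_forall_hasDefect hk h hG ht
  refine ⟨Nat.find hex, GraphClass.chromaticNumbers_eq
    (fun V _ G hG => Nat.find_spec hex V G hG.1 hG.2.le) hmin, GraphClass.chromaticNumbers_eq
    (fun V _ G hG => Nat.find_spec hex V G hG.1 hG.2)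
    (fun m d h => hmin m d fun V _ G hG => h V G ⟨hG.1, hG.2.le⟩), ?_, ?_⟩
  · have hl : Nat.sqrt (2 * k) - 1 ≤ Nat.find hex := by
      refine le_of_colorable_onlineGraph (k := k) (Nat.find_spec hex _ _ (onlineGraph_cliqueFree k)
        ((onlineOrder k).treedepth_le (onlineOrder_covers k))) ?_
      refine le_trans ?_ (Nat.sqrt_le (2 * k))
      exact Nat.mul_le_mul (Nat.sub_le _ _) (by
        have : 0 < Nat.sqrt (2 * k) := Nat.sqrt_pos.2 (by omega)
        omega)
    have hpos : 0 < Real.sqrt (2 * k) := Real.sqrt_pos.2 (by positivity)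
    have hs : Real.sqrt (2 * k) ≤ Nat.sqrt (2 * k) + 1 := by
      exact_mod_cast Real.real_sqrt_le_nat_sqrt_succ (a := 2 * k)
    have hl' : (Nat.sqrt (2 * k) : ℝ) ≤ Nat.find hex + 1 := by
      exact_mod_cast Nat.sub_le_iff_le_add.1 hl
    rw [sub_mul, div_mul_cancel₀ _ hpos.ne']
    linarith
  · refine hle.trans (Nat.cast_le (α := ℝ).1 (le_trans ?_ (Nat.le_ceil _)))
    have : ((k / 2 : ℕ) : ℝ) ≤ (k : ℝ) / 2 := Nat.cast_div_le
    push_cast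
    linarith
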